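/- Let $\mathcal C$ be a variety of universal algebras, i.e. the category of all algebras (possibly empty) of a fixed signature of finitary operations that satisfy a fixed set of identities, with all homomorphisms as morphisms. A category is called coextensive if it has finite products and, for all objects $A,B$, the canonical functor $A/\mathcal C\times B/\mathcal C\to (A\times B)/\mathcal C$, $(f,g)\mapsto f\times g$, is an equivalence. Let $F(X)$ denote the free algebra of $\mathcal C$ on a set $X$, write $F(\emptyset)^2=F(\emptyset)\times F(\emptyset)$, and let $F(X)+F(\emptyset)^2$ be the coproduct in $\mathcal C$. A diagonalising term is a $(k+2)$-ary term $t$, for some $k\ge 1$, together with constants $e_1,\dots,e_k,e_1',\dots,e_k'\in F(\emptyset)$, such that the identities $$t(x,y,e_1,\dots,e_k)=x,\qquad t(x,y,e_1',\dots,e_k')=y$$ hold in every algebra of $\mathcal C$. Given such data, define for every set $X$ the map $$\delta\colon F(X)^2\to F(X)+F(\emptyset)^2,\qquad \delta(x,y)=t\bigl(x,y,(e_1,e_1'),\dots,(e_k,e_k')\bigr),$$ where the elements $x,y$ of $F(X)$ and $(e_i,e_i')$ of $F(\emptyset)^2$ are regarded as elements of $F(X)+F(\emptyset)^2$ through the coproduct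 inclusions. **Proposition.** The variety $\mathcal C$ is coextensive if and only if it has a diagonalising term $t$ (with constants $e_i,e_i'$) such that for every set $X$: 1. $\delta(x,x)=x$ for all generators $x\in X$, where the right-hand side is the image of $x$ in $F(X)+F(\emptyset)^2$; 2. $\delta\colon F(X)^2\to F(X)+F(\emptyset)^2$ is a homomorphism. -/

import Mathlib

open CategoryTheory CategoryTheory.Limits FirstOrder FirstOrder.Language

universe u v v' u'

/-! ### Coextensive categories -/

section Coextensive

variable (C : Type u') [Category.{v'} C]

/-- The canonical functor `X/C × Y/C ⥤ (X × Y)/C` which sends a pair of morphisms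
`f : X ⟶ A`, `g : Y ⟶ B` to `f × g : X × Y ⟶ A × B`. -/
noncomputable def prodUnder [HasFiniteProducts C] (X Y : C) :
    Under X × Under Y ⥤ Under (X ⨯ Y) where
  obj p := Under.mk (prod.map p.1.hom p.2.hom)
  map {p q} φ := Under.homMk (prod.map φ.1.right φ.2.right) (by
    simp [prod.map_map])
  map_id p := by ext; all_goals simp
  map_comp φ ψ := by ext; all_goals simp

/-- A category is coextensive if it has finite products and all the canonical functors
`X/C × Y/C ⥤ (X × Y)/C` are equivalences. -/
def IsCoextensive : Prop :=
  ∃ _ : HasFiniteProducts C, ∀ X Y : C, (prodUnder C X Y).IsEquivalence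

end Coextensive

/-! ### Varieties of universal algebras

The signature is a first-order language `L` without relation symbols (`L.Functions n` is the set
of `n`-ary basic operations, and `L.Term α` is the set of terms in the variables `α`).  The variety
is given by a set `E` of identities `p.1 = p.2` between terms in countably many variables. -/

/-- An algebra in the variety of `L`-algebras defined by the identities `E`.  The carrier may be
empty when `L` has no constants. -/
structure VAlg {L : FirstOrder.Language.{u, v}} (E : Set (L.Term ℕ × L.Term ℕ)) where
  carrier : Type u
  [str : L.Structure carrier]
  sat : ∀ p ∈ E, ∀ x : ℕ → carrier, p.1.realize x = p.2.realize x

namespace VAlg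

variable {L : FirstOrder.Language.{u, v}}

instance (E : Set (L.Term ℕ × L.Term ℕ)) : CoeSort (VAlg E) (Type u) := ⟨VAlg.carrier⟩

attribute [instance] VAlg.str

/-- The variety as a category, whose morphisms are the homomorphisms. -/
instance (E : Set (L.Term ℕ × L.Term ℕ)) : Category.{u} (VAlg E) where
  Hom A B := A →[L] B
  id A := Hom.id L A
  comp f g := g.comp f

/-- A function between algebras is a homomorphism if it commutes with all basic operations. -/
def IsHomomorphism {E : Set (L.Term ℕ × L.Term ℕ)} {A B : VAlg E} (f : A → B) : Prop :=
  ∀ (n : ℕ) (s : L.Functions n) (x : Fin n → A),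
    f (Structure.funMap s x) = Structure.funMap s (fun i => f (x i))

section Product

variable [L.IsAlgebraic] {E : Set (L.Term ℕ × L.Term ℕ)}

/-- The componentwise operations on `M × N`. -/
@[reducible] def prodStructure (M N : Type u) [L.Structure M] [L.Structure N] :
    L.Structure (M × N) where
  funMap s x := (Structure.funMap s (fun i => (x i).1), Structure.funMap s (fun i => (x i).2))

theorem realize_prod {M N : Type u} [L.Structure M] [L.Structure N] {α : Type*}
    (t : L.Term α) (x : α → M × N) :
    letI := prodStructure (L := L) M N
    t.realize x = (t.realize (fun i => (x i).1), t.realize (fun i => (x i).2)) := by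
  induction t with
  | var a => rfl
  | func s ts ih => simp only [Term.realize, ih]; rfl

/-- The product `A × B` of two algebras, on the set of pairs. -/
def prod (A B : VAlg E) : VAlg E :=
  letI := prodStructure (L := L) A B
  { carrier := A × B
    sat := fun p hp x => by
      rw [realize_prod, realize_prod, A.sat p hp, B.sat p hp] }

end Product

section Presented

variable (E : Set (L.Term ℕ × L.Term ℕ)) {G : Type u}
  (R : L.Term G → L.Term G → Prop)

/-- The least congruence on the term algebra `L.Term G` that contains the relation `R` and all the
substitution instances of the identities in `E`. -/
inductive PresRel : L.Term G → L.Term G → Prop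
  | rel {a b : L.Term G} : R a b → PresRel a b
  | identity (p : L.Term ℕ × L.Term ℕ) (hp : p ∈ E) (σ : ℕ → L.Term G) :
      PresRel (p.1.subst σ) (p.2.subst σ)
  | refl (a : L.Term G) : PresRel a a
  | symm {a b : L.Term G} : PresRel a b → PresRel b a
  | trans {a b c : L.Term G} : PresRel a b → PresRel b c → PresRel a c
  | congr {n : ℕ} (s : L.Functions n) (a b : Fin n → L.Term G) :
      (∀ i, PresRel (a i) (b i)) → PresRel (Term.func s a) (Term.func s b)

theorem PresRel.realize_eq {E : Set (L.Term ℕ × L.Term ℕ)}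
    {R : L.Term G → L.Term G → Prop} {A : VAlg E} (x : G → A)
    (hx : ∀ a b, R a b → a.realize x = b.realize x) {a b : L.Term G} (h : PresRel E R a b) :
    a.realize x = b.realize x := by
  induction h with
  | rel h => exact hx _ _ h
  | identity p hp σ => rw [Term.realize_subst, Term.realize_subst]; exact A.sat p hp _
  | refl a => rfl
  | symm _ ih => exact ih.symm
  | trans _ _ ih₁ ih₂ => exact ih₁.trans ih₂
  | congr s a b _ ih => simp only [Term.realize, ih]

/-- `PresRel` as a setoid. -/
def presSetoid : Setoid (L.Term G) :=
  ⟨PresRel E R, ⟨PresRel.refl, PresRel.symm, PresRel.trans⟩⟩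

/-- The term algebra. -/
@[reducible] def termStructure [L.IsAlgebraic] (G : Type u) : L.Structure (L.Term G) where
  funMap s a := Term.func s a

variable [L.IsAlgebraic]

/-- The operations of the term algebra descend to the quotient by the congruence `PresRel`. -/
@[reducible] def presPrestructure : L.Prestructure (presSetoid E R) where
  toStructure := termStructure G
  fun_equiv {_ s} x y h := PresRel.congr s x y h
  rel_equiv {_ r} := isEmptyElim r

theorem realize_termStructure {α : Type*} (t : L.Term α) (σ : α → L.Term G) :
    letI := termStructure (L := L) G
    t.realize σ = t.subst σ := by
  induction t with
  | var a => rfl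
  | func s ts ih => simp only [Term.realize, Term.subst, ih]; rfl

/-- The algebra of the variety presented by the set of generators `G` and the relations `R`. -/
def presented : VAlg E :=
  letI := presPrestructure E R
  { carrier := Quotient (presSetoid E R)
    sat := fun p hp x => by
      have hx : x = fun i => (⟦(x i).out⟧ : Quotient (presSetoid E R)) := by
        funext i; exact (Quotient.out_eq _).symm
      rw [hx, Term.realize_quotient_mk', Term.realize_quotient_mk',
        realize_termStructure, realize_termStructure]
      exact Quotient.sound (PresRel.identity p hp _) }

/-- The element of the presented algebra that is given by a term in the generators. -/
def presented.mk (a : L.Term G) : presented E R := Quotient.mk (presSetoid E R) a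

theorem presented.funMap_mk {n : ℕ} (s : L.Functions n) (a : Fin n → L.Term G) :
    Structure.funMap s (fun i => presented.mk E R (a i)) = presented.mk E R (Term.func s a) :=
  letI := presPrestructure E R
  funMap_quotient_mk' (presSetoid E R) s a

variable {E R}

/-- The homomorphism from a presented algebra to `A` induced by a map on the generators that
respects the relations. -/
def presented.lift {A : VAlg E} (x : G → A)
    (hx : ∀ a b, R a b → a.realize x = b.realize x) : presented E R →[L] A where
  toFun := Quotient.lift (fun a : L.Term G => a.realize x) (fun _ _ h => PresRel.realize_eq x hx h)
  map_fun' {n} s y := by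
    have hy : y = fun i => presented.mk E R (Quotient.out (y i)) := by
      funext i; exact (Quotient.out_eq _).symm
    rw [hy, presented.funMap_mk]
    rfl
  map_rel' {_} r := isEmptyElim r

end Presented

section FreeAndCoproduct

variable [L.IsAlgebraic] (E : Set (L.Term ℕ × L.Term ℕ))

/-- The free algebra `F(X)`: the terms over `X` modulo the identities of the variety. -/
def free (X : Type u) : VAlg E := presented E (fun _ _ : L.Term X => False)

/-- The generators of the free algebra. -/
def free.of {X : Type u} (x : X) : free E X := presented.mk E _ (Term.var x)

/-- The free algebra `F(∅)`. -/
def freeEmpty : VAlg E := free E PEmpty.{u + 1}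

variable {E}

/-- The value in an algebra `A` of an element of `F(∅)`, that is, its image under the unique
homomorphism `F(∅) → A`. -/
def constVal (A : VAlg E) : freeEmpty E →[L] A :=
  presented.lift PEmpty.elim (fun _ _ h => h.elim)

/-- The relations that hold in `A` and in `B` between the operations and the elements. -/
inductive CoprodRel (A B : VAlg E) : L.Term (A ⊕ B) → L.Term (A ⊕ B) → Prop
  | left {n : ℕ} (s : L.Functions n) (a : Fin n → A) : CoprodRel A B
      (Term.func s (fun i => Term.var (Sum.inl (a i)))) (Term.var (Sum.inl (Structure.funMap s a)))
  | right {n : ℕ} (s : L.Functions n) (b : Fin n → B) : CoprodRel A B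
      (Term.func s (fun i => Term.var (Sum.inr (b i)))) (Term.var (Sum.inr (Structure.funMap s b)))

/-- The coproduct `A + B` in the variety: the algebra presented by the disjoint union of `A` and
`B` as generators and the operation tables of `A` and of `B` as relations. -/
def coproduct (A B : VAlg E) : VAlg E := presented E (CoprodRel A B)

/-- The coproduct inclusion `A → A + B`. -/
def coproduct.inl (A B : VAlg E) : A →[L] coproduct A B where
  toFun a := presented.mk E _ (Term.var (Sum.inl a))
  map_fun' s a := by
    refine Eq.trans ?_ (presented.funMap_mk E (CoprodRel A B) s _).symm
    exact Quotient.sound (PresRel.symm (PresRel.rel (CoprodRel.left s a)))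
  map_rel' {_} r := isEmptyElim r

/-- The coproduct inclusion `B → A + B`. -/
def coproduct.inr (A B : VAlg E) : B →[L] coproduct A B where
  toFun b := presented.mk E _ (Term.var (Sum.inr b))
  map_fun' s b := by
    refine Eq.trans ?_ (presented.funMap_mk E (CoprodRel A B) s _).symm
    exact Quotient.sound (PresRel.symm (PresRel.rel (CoprodRel.right s b)))
  map_rel' {_} r := isEmptyElim r

end FreeAndCoproduct

section Diagonalising

variable [L.IsAlgebraic] {E : Set (L.Term ℕ × L.Term ℕ)} {k : ℕ}

/-- The value `t(x, y, c₁, …, c_k)` in `A` of a `(k+2)`-ary term `t`. -/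
def termVal {A : VAlg E} (t : L.Term (Fin (k + 2))) (x y : A) (c : Fin k → A) : A :=
  t.realize (Matrix.vecCons x (Matrix.vecCons y c))

/-- The `(k+2)`-ary term `t`, with the constants `e₁, …, e_k, e₁', …, e_k'` in `F(∅)`, is a
diagonalising term: `k ≥ 1` and the identities `t(x, y, e₁, …, e_k) = x` and
`t(x, y, e₁', …, e_k') = y` hold in (every algebra of) the variety. -/
structure IsDiagonalising (t : L.Term (Fin (k + 2))) (e e' : Fin k → freeEmpty E) : Prop where
  one_le : 1 ≤ k
  fst : ∀ (A : VAlg E) (x y : A), termVal t x y (fun i => constVal A (e i)) = x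
  snd : ∀ (A : VAlg E) (x y : A), termVal t x y (fun i => constVal A (e' i)) = y

/-- The map `δ : F(X)² → F(X) + F(∅)²`, `δ(x, y) = t(x, y, (e₁, e₁'), …, (e_k, e_k'))`. -/
def delta (t : L.Term (Fin (k + 2))) (e e' : Fin k → freeEmpty E) (X : Type u) :
    prod (free E X) (free E X) → coproduct (free E X) (prod (freeEmpty E) (freeEmpty E)) :=
  fun p => termVal t
    (coproduct.inl (free E X) (prod (freeEmpty E) (freeEmpty E)) p.1)
    (coproduct.inl (free E X) (prod (freeEmpty E) (freeEmpty E)) p.2)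
    (fun i => coproduct.inr (free E X) (prod (freeEmpty E) (freeEmpty E)) (e i, e' i))

end Diagonalising

end VAlg

/-! A product decomposition of an algebra can be recorded by a binary operation m, where m(x, y)
takes its first coordinate from x and its second from y. Such an m is an idempotent homomorphism
with m(m(x, y), z) = m(x, z) = m(x, m(y, z)), and these laws suffice to recover the two factors as
quotients.

Given h : F(∅)² → Z, the candidate is `mix`, m(x, y) = t(x, y, h(eᵢ, eᵢ')). Conditions 1 and 2 are
the generic cases of idempotence and of the homomorphism property (`mix_self`, `mix_funMap`). The
absorption laws follow because m commutes with t itself (`mix_eq_mix_mix`). Hence every algebra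
under F(∅)² splits (`exists_decomposition`), and morphisms under F(∅)² respect the splitting
(`exists_eq_map`). This gives essential surjectivity and fullness; faithfulness only needs
surjective projections, which a constant provides.

Conversely, the equivalence at A = B = F(∅) is enough: it makes the canonical map F(X) + F(∅)² →
F(X)² bijective (`toSquare_bijective`). For two generators x, y, a preimage of (x, y), written as a
term in x, y and elements of F(∅)², supplies t and its constants. Then δ inverts the canonical
homomorphism for every X, which gives both conditions. -/

namespace VAlg

/-! ### Morphisms, quotients and factorizations -/

section Morphisms

variable {L : FirstOrder.Language.{u, v}} {E : Set (L.Term ℕ × L.Term ℕ)}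

instance (A B : VAlg E) : FunLike (A ⟶ B) A B := inferInstanceAs (FunLike (A →[L] B) A B)

instance (A B : VAlg E) : HomClass L (A ⟶ B) A B := inferInstanceAs (HomClass L (A →[L] B) A B)

@[simp]
theorem comp_apply {A B C : VAlg E} (f : A ⟶ B) (g : B ⟶ C) (a : A) : (f ≫ g) a = g (f a) := rfl

@[simp]
theorem id_apply {A : VAlg E} (a : A) : (𝟙 A : A ⟶ A) a = a := rfl

theorem hom_ext {A B : VAlg E} {f g : A ⟶ B} (h : ∀ a, f a = g a) : f = g :=
  DFunLike.ext _ _ h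

theorem map_funMap {A B : VAlg E} (f : A ⟶ B) {n : ℕ} (s : L.Functions n) (x : Fin n → A) :
    f (Structure.funMap s x) = Structure.funMap s (fun i => f (x i)) :=
  HomClass.map_fun f s x

theorem map_realize {A B : VAlg E} (f : A ⟶ B) {α : Type*} (t : L.Term α) (x : α → A) :
    f (t.realize x) = t.realize (fun i => f (x i)) :=
  (HomClass.realize_term f).symm

theorem injective_of_isIso {A B : VAlg E} (f : A ⟶ B) [IsIso f] : Function.Injective f :=
  Function.LeftInverse.injective (g := (inv f : B ⟶ A)) fun a => by
    rw [← comp_apply, IsIso.hom_inv_id, id_apply]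

theorem surjective_of_isIso {A B : VAlg E} (f : A ⟶ B) [IsIso f] : Function.Surjective f :=
  Function.RightInverse.surjective (g := (inv f : B ⟶ A)) fun a => by
    rw [← comp_apply, IsIso.inv_hom_id, id_apply]

theorem epi_of_surjective {A B : VAlg E} (f : A ⟶ B) (hf : Function.Surjective f) : Epi f :=
  ⟨fun g h e => hom_ext fun b => by
    obtain ⟨a, rfl⟩ := hf b
    rw [← comp_apply, e, comp_apply]⟩

variable [L.IsAlgebraic]

/-- The morphism given by a function that commutes with the operations. -/
def homMk {A B : VAlg E} (f : A → B) (hf : IsHomomorphism f) : A ⟶ B :=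
  ({ toFun := f
     map_fun' := fun {n} s x => hf n s x
     map_rel' := fun {_} r => isEmptyElim r } : A →[L] B)

theorem isIso_of_bijective {A B : VAlg E} (f : A ⟶ B) (hf : Function.Bijective f) : IsIso f := by
  let e := Equiv.ofBijective f hf
  have he : ∀ b, f (e.symm b) = b := e.apply_symm_apply
  refine ⟨homMk e.symm ?_, hom_ext fun a => e.symm_apply_apply a, hom_ext he⟩
  intro n s x
  apply hf.1
  rw [he, map_funMap]
  simp only [he]

/-- A morphism that identifies all pairs identified by the surjection `p` factors through `p`. -/
theorem exists_factorization {A B C : VAlg E} (p : A ⟶ B) (hp : Function.Surjective p)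
    (r : A ⟶ C) (h : ∀ x y, p x = p y → r x = r y) : ∃ φ : B ⟶ C, p ≫ φ = r := by
  have hs : ∀ b, p (Function.surjInv hp b) = b := Function.surjInv_eq hp
  refine ⟨homMk (fun b => r (Function.surjInv hp b)) ?_, hom_ext fun a => h _ _ (hs _)⟩
  intro n s x
  rw [← map_funMap]
  apply h
  rw [hs, map_funMap]
  simp only [hs]

/-- Every congruence is the kernel of a surjective morphism. -/
theorem exists_quotient (Z : VAlg E) (r : Setoid Z)
    (hr : ∀ {n : ℕ} (s : L.Functions n) (x y : Fin n → Z), (∀ i, r (x i) (y i)) →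
      r (Structure.funMap s x) (Structure.funMap s y)) :
    ∃ (Q : VAlg E) (p : Z ⟶ Q), Function.Surjective p ∧ ∀ x y, p x = p y ↔ r x y := by
  let _ : L.Prestructure r :=
    { toStructure := Z.str
      fun_equiv := fun {_ s} x y h => hr s x y h
      rel_equiv := fun {_ q} => isEmptyElim q }
  let Q : VAlg E :=
    { carrier := Quotient r
      sat := fun p hp x => by
        have hx : x = fun i => (⟦(x i).out⟧ : Quotient r) := by
          funext i; exact (Quotient.out_eq _).symm
        rw [hx, Term.realize_quotient_mk', Term.realize_quotient_mk']
        exact congrArg _ (Z.sat p hp _) }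
  refine ⟨Q, homMk (B := Q) (fun z => (Quotient.mk r z : Quotient r)) ?_,
    Quotient.mk_surjective, fun x y => Quotient.eq⟩
  intro n s x
  exact (funMap_quotient_mk' r s x).symm

end Morphisms

/-! ### Finite products, on pairs and as chosen limits -/

section Products

variable {L : FirstOrder.Language.{u, v}} [L.IsAlgebraic] {E : Set (L.Term ℕ × L.Term ℕ)}

/-- The first projection of the product on the set of pairs. -/
def fstHom (A B : VAlg E) : prod A B ⟶ A := homMk (A := prod A B) Prod.fst fun _ _ _ => rfl

/-- The second projection of the product on the set of pairs. -/
def sndHom (A B : VAlg E) : prod A B ⟶ B := homMk (A := prod A B) Prod.snd fun _ _ _ => rfl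

/-- The morphism into a product with given components. -/
def pairHom {A B C : VAlg E} (f : C ⟶ A) (g : C ⟶ B) : C ⟶ prod A B :=
  homMk (B := prod A B) (fun c => (f c, g c)) fun n s x => by
    simp only [map_funMap]; rfl

/-- The algebra on the set of pairs is the categorical product. -/
def prodIsLimit (A B : VAlg E) : IsLimit (BinaryFan.mk (fstHom A B) (sndHom A B)) :=
  BinaryFan.isLimitMk (fun s => pairHom s.fst s.snd) (fun _ => rfl) (fun _ => rfl)
    fun s m h₁ h₂ => hom_ext fun c => by
      rw [← h₁, ← h₂]; rfl

variable (E) in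
/-- The algebra with one element. -/
def one : VAlg E :=
  letI : L.Structure PUnit.{u + 1} := { funMap := fun _ _ => PUnit.unit }
  { carrier := PUnit.{u + 1}
    sat := fun _ _ _ => rfl }

variable (E) in
/-- The algebra with one element is terminal. -/
def oneIsTerminal : IsTerminal (one E) :=
  IsTerminal.ofUniqueHom (fun _ => homMk (B := one E) (fun _ => PUnit.unit) fun _ _ _ => rfl)
    fun _ _ => hom_ext fun _ => rfl

instance : HasFiniteProducts (VAlg E) :=
  haveI : HasTerminal (VAlg E) := (oneIsTerminal E).hasTerminal
  haveI : ∀ {A B : VAlg E}, HasLimit (pair A B) := fun {A B} => ⟨⟨⟨_, prodIsLimit A B⟩⟩⟩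
  haveI : HasBinaryProducts (VAlg E) := hasBinaryProducts_of_hasLimit_pair _
  hasFiniteProducts_of_has_binary_and_terminal

/-- A chosen categorical product is isomorphic to the algebra on the set of pairs. -/
noncomputable def prodIso (A B : VAlg E) [HasLimit (pair A B)] : A ⨯ B ≅ prod A B :=
  IsLimit.conePointUniqueUpToIso (prodIsProd A B) (prodIsLimit A B)

theorem prodIso_hom_fst (A B : VAlg E) [HasLimit (pair A B)] :
    (prodIso A B).hom ≫ fstHom A B = Limits.prod.fst :=
  IsLimit.conePointUniqueUpToIso_hom_comp (prodIsProd A B) (prodIsLimit A B)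
    ⟨WalkingPair.left⟩

theorem prodIso_hom_snd (A B : VAlg E) [HasLimit (pair A B)] :
    (prodIso A B).hom ≫ sndHom A B = Limits.prod.snd :=
  IsLimit.conePointUniqueUpToIso_hom_comp (prodIsProd A B) (prodIsLimit A B)
    ⟨WalkingPair.right⟩

theorem pairHom_prodIso_inv {A B C : VAlg E} [HasLimit (pair A B)] (f : C ⟶ A) (g : C ⟶ B) :
    pairHom f g ≫ (prodIso A B).inv = Limits.prod.lift f g := by
  rw [Iso.comp_inv_eq]
  refine BinaryFan.IsLimit.hom_ext (prodIsLimit A B) ?_ ?_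
  · change f = (Limits.prod.lift f g ≫ (prodIso A B).hom) ≫ fstHom A B
    rw [Category.assoc, prodIso_hom_fst, Limits.prod.lift_fst]
  · change g = (Limits.prod.lift f g ≫ (prodIso A B).hom) ≫ sndHom A B
    rw [Category.assoc, prodIso_hom_snd, Limits.prod.lift_snd]

theorem prodIso_hom_apply {A B : VAlg E} [HasLimit (pair A B)] (x : (A ⨯ B : VAlg E)) :
    (prodIso A B).hom x =
      ((Limits.prod.fst : A ⨯ B ⟶ A) x, (Limits.prod.snd : A ⨯ B ⟶ B) x) := by
  rw [← prodIso_hom_fst, ← prodIso_hom_snd]; rfl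

theorem prod_exists_pair {A B : VAlg E} [HasLimit (pair A B)] (a : A) (b : B) :
    ∃ x : (A ⨯ B : VAlg E), (Limits.prod.fst : A ⨯ B ⟶ A) x = a ∧
      (Limits.prod.snd : A ⨯ B ⟶ B) x = b := by
  obtain ⟨x, hx⟩ := surjective_of_isIso (prodIso A B).hom ((a, b) : A × B)
  rw [prodIso_hom_apply] at hx
  exact ⟨x, congrArg Prod.fst hx, congrArg Prod.snd hx⟩

theorem prod_elem_ext {A B : VAlg E} [HasLimit (pair A B)] {x y : (A ⨯ B : VAlg E)}
    (h₁ : (Limits.prod.fst : A ⨯ B ⟶ A) x = (Limits.prod.fst : A ⨯ B ⟶ A) y)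
    (h₂ : (Limits.prod.snd : A ⨯ B ⟶ B) x = (Limits.prod.snd : A ⨯ B ⟶ B) y) : x = y := by
  apply injective_of_isIso (prodIso A B).hom
  rw [prodIso_hom_apply, prodIso_hom_apply, h₁, h₂]

end Products

/-! ### Universal properties of free algebras and coproducts -/

section Presentations

variable {L : FirstOrder.Language.{u, v}} [L.IsAlgebraic] {E : Set (L.Term ℕ × L.Term ℕ)}

theorem presented.mk_eq_realize {G : Type u} (R : L.Term G → L.Term G → Prop) (a : L.Term G) :
    presented.mk E R a = a.realize (fun g => presented.mk E R (Term.var g)) := by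
  induction a with
  | var g => rfl
  | func s ts ih => rw [← presented.funMap_mk]; simp only [ih]; rfl

theorem presented.hom_ext {G : Type u} {R : L.Term G → L.Term G → Prop} {A : VAlg E}
    {f g : presented E R ⟶ A}
    (h : ∀ x, f (presented.mk E R (Term.var x)) = g (presented.mk E R (Term.var x))) : f = g := by
  refine VAlg.hom_ext fun a => ?_
  obtain ⟨a, rfl⟩ := Quotient.exists_rep a
  change f (presented.mk E R a) = g (presented.mk E R a)
  rw [presented.mk_eq_realize, map_realize, map_realize]
  simp only [h]

/-- The homomorphism from a free algebra that extends a map on the generators. -/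
def free.lift {X : Type u} {A : VAlg E} (x : X → A) : free E X ⟶ A :=
  presented.lift x fun _ _ h => h.elim

@[simp]
theorem free.lift_of {X : Type u} {A : VAlg E} (f : X → A) (x : X) :
    free.lift f (free.of E x) = f x := rfl

theorem free.hom_ext {X : Type u} {A : VAlg E} {f g : free E X ⟶ A}
    (h : ∀ x, f (free.of E x) = g (free.of E x)) : f = g :=
  presented.hom_ext h

/-- The unique morphism from `F(∅)`. -/
def fromEmpty (A : VAlg E) : freeEmpty E ⟶ A := constVal A

theorem fromEmpty_ext {A : VAlg E} (f g : freeEmpty E ⟶ A) : f = g :=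
  presented.hom_ext fun x => x.elim

theorem map_constVal {A B : VAlg E} (f : A ⟶ B) (c : freeEmpty E) :
    f (constVal A c) = constVal B c :=
  DFunLike.congr_fun (fromEmpty_ext (fromEmpty A ≫ f) (fromEmpty B)) c

/-- The left coproduct inclusion as a morphism. -/
def inlHom (A B : VAlg E) : A ⟶ coproduct A B := coproduct.inl A B

/-- The right coproduct inclusion as a morphism. -/
def inrHom (A B : VAlg E) : B ⟶ coproduct A B := coproduct.inr A B

theorem coproduct.hom_ext {A B C : VAlg E} {f g : coproduct A B ⟶ C}
    (h₁ : inlHom A B ≫ f = inlHom A B ≫ g) (h₂ : inrHom A B ≫ f = inrHom A B ≫ g) : f = g :=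
  presented.hom_ext fun
    | .inl a => DFunLike.congr_fun h₁ a
    | .inr b => DFunLike.congr_fun h₂ b

/-- The morphism from a coproduct with given components. -/
def coproduct.desc {A B C : VAlg E} (f : A ⟶ C) (g : B ⟶ C) : coproduct A B ⟶ C :=
  presented.lift (Sum.elim f g) fun _ _ h => by
    cases h with
    | left s a => exact (map_funMap f s a).symm
    | right s b => exact (map_funMap g s b).symm

end Presentations

end VAlg
-- Decomposition of algebras under F(∅)² by a diagonalising term
namespace VAlg

variable {L : FirstOrder.Language.{u, v}} {E : Set (L.Term ℕ × L.Term ℕ)} {k : ℕ}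

theorem map_termVal {A B : VAlg E} (f : A ⟶ B) (t : L.Term (Fin (k + 2))) (x y : A)
    (c : Fin k → A) : f (termVal t x y c) = termVal t (f x) (f y) (fun i => f (c i)) := by
  unfold termVal
  rw [map_realize]
  congr 1
  funext i
  refine Fin.cases rfl (fun i => ?_) i
  exact Fin.cases rfl (fun i => rfl) i

/-- A term in two distinguished variables and further parameters depends on finitely many
parameters. -/
theorem exists_termVal_eq {D : Type u} [Nonempty D] (t : L.Term (ULift.{u} (Fin 2) ⊕ D)) :
    ∃ (k : ℕ) (t' : L.Term (Fin (k + 2))) (d : Fin k → D), 1 ≤ k ∧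
      ∀ (A : VAlg E) (x : ULift.{u} (Fin 2) → A) (y : D → A),
        termVal t' (x ⟨0⟩) (x ⟨1⟩) (fun i => y (d i)) = t.realize (Sum.elim x y) := by
  classical
  let d₀ : D := Classical.arbitrary D
  let S := t.varFinset
  -- The extra entry `d₀` guarantees k ≥ 1. Slots belonging to the two distinguished variables are
  -- also filled with `d₀` and never used.
  let d : Fin (S.card + 1) → D :=
    Fin.cons d₀ fun i => Sum.elim (fun _ => d₀) id (S.equivFin.symm i).1
  -- Three successors skip the two distinguished variables and the extra entry `d₀`.
  let f : S → Fin (S.card + 1 + 2) := fun a =>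
    Sum.elim (fun i => Fin.castLE (by omega) i.down) (fun _ => (S.equivFin a).succ.succ.succ) a.1
  refine ⟨S.card + 1, t.restrictVar f, d, by omega, fun A x y => ?_⟩
  refine Term.realize_restrictVar _ fun a => ?_
  obtain ⟨⟨i⟩ | b, ha⟩ := a
  · fin_cases i <;> rfl
  · change y (Sum.elim (fun _ => d₀) id (S.equivFin.symm (S.equivFin ⟨Sum.inr b, ha⟩)).1) = y b
    rw [Equiv.symm_apply_apply]
    rfl

section Decomposition

variable [L.IsAlgebraic] (t : L.Term (Fin (k + 2))) (e e' : Fin k → freeEmpty E)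

/-- The binary operation `t(x, y, h(e₁, e₁'), …, h(e_k, e_k'))` on an algebra `Z` equipped with
a morphism `h : F(∅)² ⟶ Z`. -/
def mix {Z : VAlg E} (h : prod (freeEmpty E) (freeEmpty E) ⟶ Z) (x y : Z) : Z :=
  termVal t x y (fun i => h (e i, e' i))

theorem map_mix {Z W : VAlg E} (h : prod (freeEmpty E) (freeEmpty E) ⟶ Z) (f : Z ⟶ W) (x y : Z) :
    f (mix t e e' h x y) = mix t e e' (h ≫ f) (f x) (f y) :=
  map_termVal f t x y _

/-- The conditions on a diagonalising term under which it decomposes all algebras under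
`F(∅)²`. -/
structure IsDecomposing : Prop where
  isDiagonalising : IsDiagonalising t e e'
  delta_of : ∀ (X : Type u) (x : X), delta t e e' X (free.of E x, free.of E x) =
    coproduct.inl (free E X) (prod (freeEmpty E) (freeEmpty E)) (free.of E x)
  delta_hom : ∀ X : Type u, IsHomomorphism (delta t e e' X)

variable {t e e'} {Z : VAlg E} (h : prod (freeEmpty E) (freeEmpty E) ⟶ Z)

/-- Since δ is given by a term, its image under any morphism out of F(X) + F(∅)² is `mix`; this
carries facts about δ to every algebra under F(∅)². -/
theorem desc_delta {X : Type u} (x : X → Z) (p q : free E X) :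
    coproduct.desc (free.lift x) h (delta t e e' X (p, q)) =
      mix t e e' h (free.lift x p) (free.lift x q) :=
  map_termVal (coproduct.desc (free.lift x) h) t _ _ _

namespace IsDecomposing

variable (H : IsDecomposing t e e')

include H

theorem mix_self (x : Z) : mix t e e' h x x = x := by
  have h₁ := desc_delta (t := t) (e := e) (e' := e') h (X := Z) id (free.of E x) (free.of E x)
  rw [H.delta_of] at h₁
  exact h₁.symm

theorem mix_funMap {n : ℕ} (s : L.Functions n) (x y : Fin n → Z) :
    mix t e e' h (Structure.funMap s x) (Structure.funMap s y) =
      Structure.funMap s (fun i => mix t e e' h (x i) (y i)) := by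
  -- The generic instance lives on 2n free generators, one for each entry of `x` and `y`.
  let v : ULift.{u} (Fin n ⊕ Fin n) → Z := fun i => Sum.elim x y i.down
  have h₁ := H.delta_hom (ULift.{u} (Fin n ⊕ Fin n)) n s
    (fun i => (free.of E ⟨.inl i⟩, free.of E ⟨.inr i⟩))
  replace h₁ := congrArg (coproduct.desc (free.lift v) h) h₁
  rw [map_funMap] at h₁
  simp only [desc_delta, free.lift_of] at h₁
  refine Eq.trans ?_ h₁
  refine Eq.trans ?_ (desc_delta h v _ _).symm
  rw [map_funMap, map_funMap]
  rfl

/-- As a homomorphism Z × Z → Z, `mix` preserves the term t, which is evaluated componentwise on Z ×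
Z. -/
theorem mix_termVal (x x' y y' : Z) (c c' : Fin k → Z) :
    mix t e e' h (termVal t x x' c) (termVal t y y' c') =
      termVal t (mix t e e' h x y) (mix t e e' h x' y') (fun i => mix t e e' h (c i) (c' i)) := by
  let f : prod Z Z ⟶ Z := homMk (A := prod Z Z) (fun p => mix t e e' h p.1 p.2)
    fun n s x => H.mix_funMap h s _ _
  have h₁ := map_termVal f t (x, y) (x', y') (fun i => (c i, c' i))
  refine Eq.trans ?_ h₁
  have h₂ := map_termVal (fstHom Z Z) t (x, y) (x', y') (fun i => (c i, c' i))
  have h₃ := map_termVal (sndHom Z Z) t (x, y) (x', y') (fun i => (c i, c' i))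
  exact (congrArg₂ (mix t e e' h) h₂ h₃).symm

-- After `p` the parameters h(eᵢ, eᵢ') become the constants eᵢ, for which t returns its first
-- argument.
omit H in
theorem _root_.VAlg.IsDiagonalising.map_mix_of_fst (H : IsDiagonalising t e e') {A : VAlg E}
    (p : Z ⟶ A) (hp : h ≫ p = fstHom _ _ ≫ fromEmpty A) (x y : Z) :
    p (mix t e e' h x y) = p x := by
  rw [map_mix, hp]
  exact H.fst A _ _

omit H in
theorem _root_.VAlg.IsDiagonalising.map_mix_of_snd (H : IsDiagonalising t e e') {A : VAlg E}
    (p : Z ⟶ A) (hp : h ≫ p = sndHom _ _ ≫ fromEmpty A) (x y : Z) :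
    p (mix t e e' h x y) = p y := by
  rw [map_mix, hp]
  exact H.snd A _ _

/-- It suffices to compute in F(∅)² and apply h: there `mix` of (c, c) and (c', c') has components c
and c' by the diagonalising identities. -/
theorem mix_constVal (c c' : freeEmpty E) :
    mix t e e' h (constVal Z c) (constVal Z c') = h (c, c') := by
  have h₁ := map_mix t e e' (𝟙 (prod (freeEmpty E) (freeEmpty E))) h (constVal _ c) (constVal _ c')
  rw [Category.id_comp, map_constVal, map_constVal] at h₁
  rw [← h₁]
  congr 1
  have k₁ := H.isDiagonalising.map_mix_of_fst (𝟙 (prod (freeEmpty E) (freeEmpty E))) (fstHom _ _)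
    (hom_ext fun a => DFunLike.congr_fun (fromEmpty_ext (𝟙 _) (fromEmpty (freeEmpty E))) a.1)
    (constVal _ c) (constVal _ c')
  have k₂ := H.isDiagonalising.map_mix_of_snd (𝟙 (prod (freeEmpty E) (freeEmpty E))) (sndHom _ _)
    (hom_ext fun a => DFunLike.congr_fun (fromEmpty_ext (𝟙 _) (fromEmpty (freeEmpty E))) a.2)
    (constVal _ c) (constVal _ c')
  rw [map_constVal] at k₁ k₂
  have k₃ : ∀ c, constVal (freeEmpty E) c = c := fun c =>
    DFunLike.congr_fun (fromEmpty_ext (fromEmpty (freeEmpty E)) (𝟙 _)) c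
  rw [k₃] at k₁ k₂
  exact Prod.ext k₁ k₂

/-- Write x as t(x, z, e) and w as t(y, w, e'), then interchange `mix` with t. The parameters become
m(eᵢ, eᵢ') = h(eᵢ, eᵢ'), so the outer t is again `mix`. -/
theorem mix_eq_mix_mix (x y z w : Z) :
    mix t e e' h x w = mix t e e' h (mix t e e' h x y) (mix t e e' h z w) := by
  have h₁ := H.mix_termVal h x z y w (fun i => constVal Z (e i)) (fun i => constVal Z (e' i))
  rw [H.isDiagonalising.fst, H.isDiagonalising.snd] at h₁
  refine h₁.trans ?_
  simp only [H.mix_constVal]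
  rfl

theorem mix_mix_left (x y z : Z) :
    mix t e e' h (mix t e e' h x y) z = mix t e e' h x z := by
  rw [H.mix_eq_mix_mix h x y z z, H.mix_self h z]

theorem mix_mix_right (x y z : Z) :
    mix t e e' h x (mix t e e' h y z) = mix t e e' h x z := by
  rw [H.mix_eq_mix_mix h x x y z, H.mix_self h x]

/-- An algebra under `F(∅)²` is the product of two of its quotients. -/
theorem exists_decomposition :
    ∃ (Q₁ Q₂ : VAlg E) (p₁ : Z ⟶ Q₁) (p₂ : Z ⟶ Q₂),
      (∀ x y, p₁ x = p₁ y ↔ mix t e e' h x y = y) ∧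
      (∀ x y, p₂ x = p₂ y ↔ mix t e e' h x y = x) ∧
      IsIso (Limits.prod.lift p₁ p₂) := by
  -- The relation m(x, y) = y expresses equality of first coordinates, and m(x, y) = x equality of
  -- second ones.
  obtain ⟨Q₁, p₁, s₁, k₁⟩ := exists_quotient Z
    { r := fun x y => mix t e e' h x y = y
      iseqv := ⟨H.mix_self h,
        fun {x y} hxy => by rw [← hxy, H.mix_mix_left, H.mix_self],
        fun {x y z} hxy hyz => by rw [← hyz, ← hxy, H.mix_mix_left, H.mix_mix_right]⟩ }
    fun s x y hxy => (H.mix_funMap h s x y).trans (congrArg _ (funext hxy))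
  obtain ⟨Q₂, p₂, s₂, k₂⟩ := exists_quotient Z
    { r := fun x y => mix t e e' h x y = x
      iseqv := ⟨H.mix_self h,
        fun {x y} hxy => by rw [← hxy, H.mix_mix_right, H.mix_self],
        fun {x y z} hxy hyz => by rw [← H.mix_mix_right h x y z, hyz, hxy]⟩ }
    fun s x y hxy => (H.mix_funMap h s x y).trans (congrArg _ (funext hxy))
  refine ⟨Q₁, Q₂, p₁, p₂, k₁, k₂, isIso_of_bijective _ ⟨fun x y hxy => ?_, fun z => ?_⟩⟩
  · have h₁ := congrArg (Limits.prod.fst : Q₁ ⨯ Q₂ ⟶ Q₁) hxy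
    have h₂ := congrArg (Limits.prod.snd : Q₁ ⨯ Q₂ ⟶ Q₂) hxy
    simp only [← comp_apply, Limits.prod.lift_fst, Limits.prod.lift_snd] at h₁ h₂
    exact ((k₂ x y).1 h₂).symm.trans ((k₁ x y).1 h₁)
  · obtain ⟨x, hx⟩ := s₁ ((Limits.prod.fst : Q₁ ⨯ Q₂ ⟶ Q₁) z)
    obtain ⟨y, hy⟩ := s₂ ((Limits.prod.snd : Q₁ ⨯ Q₂ ⟶ Q₂) z)
    refine ⟨mix t e e' h x y, prod_elem_ext ?_ ?_⟩
    · rw [← hx, ← comp_apply, Limits.prod.lift_fst]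
      exact ((k₁ _ _).2 (H.mix_mix_right h x x y)).symm
    · rw [← hy, ← comp_apply, Limits.prod.lift_snd]
      exact (k₂ _ _).2 (H.mix_mix_left h x y y)

end IsDecomposing

end Decomposition

end VAlg
-- From decompositions to coextensivity
namespace VAlg

variable {L : FirstOrder.Language.{u, v}} [L.IsAlgebraic] {E : Set (L.Term ℕ × L.Term ℕ)}

theorem prod_fst_surjective {A B : VAlg E} (b : B) :
    Function.Surjective (Limits.prod.fst : A ⨯ B ⟶ A) :=
  fun a => (prod_exists_pair a b).imp fun _ h => h.1

theorem prod_snd_surjective {A B : VAlg E} (a : A) :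
    Function.Surjective (Limits.prod.snd : A ⨯ B ⟶ B) :=
  fun b => (prod_exists_pair a b).imp fun _ h => h.2

theorem epi_prod_fst (c : freeEmpty E) (A B : VAlg E) : Epi (Limits.prod.fst : A ⨯ B ⟶ A) :=
  epi_of_surjective _ (prod_fst_surjective (constVal B c))

theorem epi_prod_snd (c : freeEmpty E) (A B : VAlg E) : Epi (Limits.prod.snd : A ⨯ B ⟶ B) :=
  epi_of_surjective _ (prod_snd_surjective (constVal A c))

theorem prodUnder_faithful (c : freeEmpty E) (A B : VAlg E) :
    (prodUnder (VAlg E) A B).Faithful where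
  map_injective {p q} φ ψ hφ := by
    have := epi_prod_fst c p.1.right p.2.right
    have := epi_prod_snd c p.1.right p.2.right
    have h : Limits.prod.map φ.1.right φ.2.right = Limits.prod.map ψ.1.right ψ.2.right :=
      congrArg CommaMorphism.right hφ
    have h₁ := congrArg (· ≫ Limits.prod.fst) h
    have h₂ := congrArg (· ≫ Limits.prod.snd) h
    simp only [Limits.prod.map_fst, Limits.prod.map_snd, cancel_epi] at h₁ h₂
    exact Prod.ext (Under.UnderMorphism.ext h₁) (Under.UnderMorphism.ext h₂)

section

variable (A B : VAlg E)

/-- The canonical morphism from `F(∅)²` to a product. -/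
noncomputable def constPair : prod (freeEmpty E) (freeEmpty E) ⟶ A ⨯ B :=
  Limits.prod.lift (fstHom _ _ ≫ fromEmpty A) (sndHom _ _ ≫ fromEmpty B)

theorem constPair_fst : constPair A B ≫ Limits.prod.fst = fstHom _ _ ≫ fromEmpty A :=
  Limits.prod.lift_fst _ _

theorem constPair_snd : constPair A B ≫ Limits.prod.snd = sndHom _ _ ≫ fromEmpty B :=
  Limits.prod.lift_snd _ _

variable {A B}

theorem constPair_map {A' B' : VAlg E} (f : A ⟶ A') (g : B ⟶ B') :
    constPair A B ≫ Limits.prod.map f g = constPair A' B' := by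
  unfold constPair
  rw [Limits.prod.lift_map, Category.assoc, Category.assoc]
  congr 2 <;> exact fromEmpty_ext _ _

end

namespace IsDecomposing

variable {k : ℕ} {t : L.Term (Fin (k + 2))} {e e' : Fin k → freeEmpty E}
  (H : IsDecomposing t e e')

include H

theorem mix_eq_right_of_fst_eq {A B : VAlg E} {x y : (A ⨯ B : VAlg E)}
    (h : (Limits.prod.fst : A ⨯ B ⟶ A) x = (Limits.prod.fst : A ⨯ B ⟶ A) y) :
    mix t e e' (constPair A B) x y = y := by
  apply prod_elem_ext
  · rw [H.isDiagonalising.map_mix_of_fst _ _ (constPair_fst A B), h]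
  · rw [H.isDiagonalising.map_mix_of_snd _ _ (constPair_snd A B)]

theorem mix_eq_left_of_snd_eq {A B : VAlg E} {x y : (A ⨯ B : VAlg E)}
    (h : (Limits.prod.snd : A ⨯ B ⟶ B) x = (Limits.prod.snd : A ⨯ B ⟶ B) y) :
    mix t e e' (constPair A B) x y = x := by
  apply prod_elem_ext
  · rw [H.isDiagonalising.map_mix_of_fst _ _ (constPair_fst A B)]
  · rw [H.isDiagonalising.map_mix_of_snd _ _ (constPair_snd A B), h]

/-- A morphism between products that is compatible with the canonical morphisms from `F(∅)²`
is a product of two morphisms. -/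
theorem exists_eq_map {A B A' B' : VAlg E} (u : A ⨯ B ⟶ A' ⨯ B')
    (hu : constPair A B ≫ u = constPair A' B') :
    ∃ (φ : A ⟶ A') (ψ : B ⟶ B'), Limits.prod.map φ ψ = u := by
  let c : freeEmpty E := e ⟨0, H.isDiagonalising.one_le⟩
  -- If `x` and `y` share their first coordinate, then y = m(x, y). As `u` preserves m, the first
  -- coordinate of u(y) is that of u(x).
  obtain ⟨φ, hφ⟩ := exists_factorization (Limits.prod.fst : A ⨯ B ⟶ A)
    (prod_fst_surjective (constVal B c)) (u ≫ Limits.prod.fst) fun x y hxy => by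
      rw [← H.mix_eq_right_of_fst_eq hxy, comp_apply, comp_apply, map_mix, hu,
        H.isDiagonalising.map_mix_of_fst _ _ (constPair_fst A' B')]
  obtain ⟨ψ, hψ⟩ := exists_factorization (Limits.prod.snd : A ⨯ B ⟶ B)
    (prod_snd_surjective (constVal A c)) (u ≫ Limits.prod.snd) fun x y hxy => by
      rw [← H.mix_eq_left_of_snd_eq hxy, comp_apply, comp_apply, map_mix, hu,
        H.isDiagonalising.map_mix_of_snd _ _ (constPair_snd A' B')]
  exact ⟨φ, ψ, Limits.prod.hom_ext (by simp [hφ]) (by simp [hψ])⟩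

theorem prodUnder_full (A B : VAlg E) : (prodUnder (VAlg E) A B).Full where
  map_surjective {p q} v := by
    let c : freeEmpty E := e ⟨0, H.isDiagonalising.one_le⟩
    -- Cancelling the projections turns compatibility of φ × ψ with the structure maps into
    -- compatibility of φ and ψ separately.
    have := epi_prod_fst c A B
    have := epi_prod_snd c A B
    let u : p.1.right ⨯ p.2.right ⟶ q.1.right ⨯ q.2.right := v.right
    have hv : Limits.prod.map p.1.hom p.2.hom ≫ u = Limits.prod.map q.1.hom q.2.hom := Under.w v
    obtain ⟨φ, ψ, h⟩ := H.exists_eq_map u (by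
      rw [← constPair_map p.1.hom p.2.hom, Category.assoc, hv, constPair_map])
    rw [← h, Limits.prod.map_map] at hv
    have h₁ := congrArg (· ≫ Limits.prod.fst) hv
    have h₂ := congrArg (· ≫ Limits.prod.snd) hv
    simp only [Limits.prod.map_fst, Limits.prod.map_snd, cancel_epi] at h₁ h₂
    exact ⟨(Under.homMk φ h₁, Under.homMk ψ h₂), Under.UnderMorphism.ext h⟩

theorem prodUnder_essSurj (A B : VAlg E) : (prodUnder (VAlg E) A B).EssSurj where
  mem_essImage W := by
    let c : freeEmpty E := e ⟨0, H.isDiagonalising.one_le⟩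
    let h : A ⨯ B ⟶ W.right := W.hom
    obtain ⟨Q₁, Q₂, p₁, p₂, k₁, k₂, hiso⟩ := H.exists_decomposition (constPair A B ≫ h)
    -- The relation m(x, y) = y holds in A × B when first coordinates agree, and `h` carries it to
    -- the relation defining `p₁`.
    obtain ⟨f, hf⟩ := exists_factorization (Limits.prod.fst : A ⨯ B ⟶ A)
      (prod_fst_surjective (constVal B c)) (h ≫ p₁) fun x y hxy => (k₁ _ _).2 (by
        rw [← map_mix, H.mix_eq_right_of_fst_eq hxy])
    obtain ⟨g, hg⟩ := exists_factorization (Limits.prod.snd : A ⨯ B ⟶ B)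
      (prod_snd_surjective (constVal A c)) (h ≫ p₂) fun x y hxy => (k₂ _ _).2 (by
        rw [← map_mix, H.mix_eq_left_of_snd_eq hxy])
    have hfg : h ≫ Limits.prod.lift p₁ p₂ = Limits.prod.map f g :=
      Limits.prod.hom_ext
        (by rw [Category.assoc, Limits.prod.lift_fst, Limits.prod.map_fst, hf])
        (by rw [Category.assoc, Limits.prod.lift_snd, Limits.prod.map_snd, hg])
    exact ⟨(Under.mk f, Under.mk g),
      ⟨(Under.isoMk (@asIso _ _ _ _ (Limits.prod.lift p₁ p₂) hiso) hfg).symm⟩⟩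

theorem isCoextensive : IsCoextensive (VAlg E) :=
  ⟨inferInstance, fun A B =>
    { faithful := prodUnder_faithful (e ⟨0, H.isDiagonalising.one_le⟩) A B
      full := H.prodUnder_full A B
      essSurj := H.prodUnder_essSurj A B }⟩

end IsDecomposing

/-! ### From coextensivity to a diagonalising term -/

section Coextensive

/-- The canonical morphism `F(X) + F(∅)² ⟶ F(X)²`. -/
def toSquare (X : Type u) : coproduct (free E X) (prod (freeEmpty E) (freeEmpty E)) ⟶
    prod (free E X) (free E X) :=
  coproduct.desc (pairHom (𝟙 _) (𝟙 _))
    (pairHom (fstHom _ _ ≫ fromEmpty _) (sndHom _ _ ≫ fromEmpty _))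

/-- If F(∅) were empty, so would be F(∅) × 1 and F(∅)². The empty map between them would be a
morphism under F(∅)², and fullness would produce a morphism 1 → F(∅). -/
theorem nonempty_freeEmpty_of_full
    (h : (prodUnder (VAlg E) (freeEmpty E) (freeEmpty E)).Full) : Nonempty (freeEmpty E) := by
  by_contra hne
  rw [not_nonempty_iff] at hne
  let o : VAlg E := freeEmpty E
  have hempty : ∀ {A : VAlg E}, IsEmpty (o ⨯ A : VAlg E) := fun {A} =>
    ⟨fun x => hne.false ((Limits.prod.fst : o ⨯ A ⟶ o) x)⟩
  let p : Under o × Under o := (Under.mk (𝟙 o), Under.mk (fromEmpty (one E)))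
  let q : Under o × Under o := (Under.mk (𝟙 o), Under.mk (𝟙 o))
  let u : o ⨯ one E ⟶ o ⨯ o :=
    homMk (fun x => (hempty.false x).elim) fun _ s x => (hempty.false (Structure.funMap s x)).elim
  let v : (prodUnder (VAlg E) o o).obj p ⟶ (prodUnder (VAlg E) o o).obj q :=
    Under.homMk u (hom_ext fun x => (hempty.false x).elim)
  obtain ⟨w, -⟩ := h.map_surjective v
  let w₂ : one E ⟶ o := w.2.right
  exact hne.false (w₂ PUnit.unit)

/-- Essential surjectivity splits F(X) + F(∅)² as a product, and fullness splits the canonical map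
as φ × ψ. The components of the inclusion of F(X) into this product are sections of φ and ψ, and
their product yields the inverse. -/
theorem toSquare_bijective
    (h : (prodUnder (VAlg E) (freeEmpty E) (freeEmpty E)).IsEquivalence) (X : Type u) :
    Function.Bijective (toSquare (E := E) X) := by
  let o : VAlg E := freeEmpty E
  let Z := coproduct (free E X) (prod o o)
  let θ := prodIso o o
  let κ : Z ⟶ free E X ⨯ free E X := toSquare X ≫ (prodIso _ _).inv
  let W : Under (o ⨯ o) := Under.mk (θ.hom ≫ inrHom (free E X) (prod o o))
  let P := prodUnder (VAlg E) o o
  obtain ⟨p, ⟨i⟩⟩ := h.essSurj.mem_essImage W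
  let j : p.1.right ⨯ p.2.right ≅ Z := (Under.forget _).mapIso i
  have hj : Limits.prod.map p.1.hom p.2.hom ≫ j.hom = θ.hom ≫ inrHom _ _ := Under.w i.hom
  have hl : inlHom _ _ ≫ κ = Limits.prod.lift (𝟙 _) (𝟙 _) := by
    change pairHom (𝟙 _) (𝟙 _) ≫ (prodIso _ _).inv = _
    rw [pairHom_prodIso_inv]
  have hr : θ.hom ≫ inrHom _ _ ≫ κ = Limits.prod.map (fromEmpty _) (fromEmpty _) := by
    change (prodIso o o).hom ≫ pairHom _ _ ≫ (prodIso _ _).inv = _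
    rw [pairHom_prodIso_inv, Limits.prod.comp_lift, ← Category.assoc, ← Category.assoc,
      prodIso_hom_fst, prodIso_hom_snd]
    exact Limits.prod.hom_ext (by rw [Limits.prod.lift_fst, Limits.prod.map_fst])
      (by rw [Limits.prod.lift_snd, Limits.prod.map_snd])
  let q : Under o × Under o := (Under.mk (fromEmpty (free E X)), Under.mk (fromEmpty (free E X)))
  let v : P.obj p ⟶ P.obj q := Under.homMk (j.hom ≫ κ) (by
    change Limits.prod.map p.1.hom p.2.hom ≫ j.hom ≫ κ = Limits.prod.map (fromEmpty _) (fromEmpty _)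
    rw [← hr, ← Category.assoc, hj, Category.assoc])
  obtain ⟨w, hw⟩ := h.full.map_surjective v
  let φ : p.1.right ⟶ free E X := w.1.right
  let ψ : p.2.right ⟶ free E X := w.2.right
  have hφψ : Limits.prod.map φ ψ = j.hom ≫ κ := congrArg CommaMorphism.right hw
  let ι₁ : free E X ⟶ p.1.right := inlHom _ _ ≫ j.inv ≫ Limits.prod.fst
  let ι₂ : free E X ⟶ p.2.right := inlHom _ _ ≫ j.inv ≫ Limits.prod.snd
  let ρ : free E X ⨯ free E X ⟶ Z := Limits.prod.map ι₁ ι₂ ≫ j.hom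
  -- Tested on the two inclusions: on F(X) the components `ι₁`, `ι₂` reassemble the inclusion, and
  -- on F(∅)² initiality of F(∅) applies in each factor.
  have h₁ : κ ≫ ρ = 𝟙 Z := by
    apply coproduct.hom_ext
    · rw [← Category.assoc, hl, ← Category.assoc, Limits.prod.lift_map]
      rw [← Iso.eq_comp_inv, Category.comp_id]
      exact Limits.prod.hom_ext
        (by rw [Limits.prod.lift_fst, Category.id_comp, Category.assoc])
        (by rw [Limits.prod.lift_snd, Category.id_comp, Category.assoc])
    · rw [← cancel_epi θ.hom, Category.comp_id, ← hj, ← Category.assoc (inrHom _ _) κ ρ,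
        ← Category.assoc, hr, ← Category.assoc, Limits.prod.map_map]
      congr 2 <;> exact fromEmpty_ext _ _
  have h₂ : ρ ≫ κ = 𝟙 _ := by
    have hκ : κ = j.inv ≫ Limits.prod.map φ ψ := by rw [hφψ, Iso.inv_hom_id_assoc]
    have e₁ : ι₁ ≫ φ = 𝟙 _ := by
      have h₃ := congrArg (· ≫ Limits.prod.fst) hl
      simp only [hκ, Category.assoc, Limits.prod.map_fst] at h₃
      rw [Limits.prod.lift_fst] at h₃
      simpa only [ι₁, Category.assoc] using h₃
    have e₂ : ι₂ ≫ ψ = 𝟙 _ := by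
      have h₃ := congrArg (· ≫ Limits.prod.snd) hl
      simp only [hκ, Category.assoc, Limits.prod.map_snd] at h₃
      rw [Limits.prod.lift_snd] at h₃
      simpa only [ι₂, Category.assoc] using h₃
    rw [Category.assoc, ← hφψ, Limits.prod.map_map, e₁, e₂, Limits.prod.map_id_id]
  have hκ : IsIso κ := ⟨ρ, h₁, h₂⟩
  have : IsIso (toSquare (E := E) X) := IsIso.of_isIso_comp_right (toSquare X) (prodIso _ _).inv
  exact ⟨injective_of_isIso _, surjective_of_isIso _⟩

/-- Every element of `F(X) + A` is the value of a term at generators of `F(X)` and elements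
of `A`. -/
theorem exists_term_of_coproduct {X : Type u} {A : VAlg E} (w : coproduct (free E X) A) :
    ∃ t : L.Term (X ⊕ A),
      t.realize (Sum.elim (fun x => inlHom (free E X) A (free.of E x)) (inrHom (free E X) A)) =
        w := by
  have hfunc : ∀ {α : Type u} (R : L.Term α → L.Term α → Prop) {n : ℕ} (s : L.Functions n)
      (a : Fin n → L.Term α), presented.mk E R (Term.func s a) =
        Structure.funMap s fun i => presented.mk E R (a i) :=
    fun R _ s a => (presented.funMap_mk E R s a).symm
  obtain ⟨a, rfl⟩ := Quotient.exists_rep w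
  change ∃ t : L.Term (X ⊕ A), t.realize _ = presented.mk E _ a
  induction a with
  | var g =>
    rcases g with p | b
    · obtain ⟨p, rfl⟩ := Quotient.exists_rep p
      refine ⟨p.relabel Sum.inl, ?_⟩
      refine (Term.realize_relabel ..).trans (Eq.trans ?_
        (congrArg (inlHom (free E X) A) (presented.mk_eq_realize _ p).symm))
      exact (map_realize (inlHom (free E X) A) p _).symm
    · exact ⟨Term.var (Sum.inr b), rfl⟩
  | func s ts ih =>
    choose t ht using ih
    refine ⟨Term.func s t, ?_⟩
    rw [hfunc]
    simp only [← ht]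
    rfl

theorem exists_isDecomposing
    (h : (prodUnder (VAlg E) (freeEmpty E) (freeEmpty E)).IsEquivalence) :
    ∃ (k : ℕ) (t : L.Term (Fin (k + 2))) (e e' : Fin k → freeEmpty E), IsDecomposing t e e' := by
  let X := ULift.{u} (Fin 2)
  let D := prod (freeEmpty E) (freeEmpty E)
  obtain ⟨c⟩ := nonempty_freeEmpty_of_full h.full
  have : Nonempty D := ⟨(c, c)⟩
  obtain ⟨w, hw⟩ := (toSquare_bijective h X).2 (free.of E ⟨0⟩, free.of E ⟨1⟩)
  obtain ⟨s, rfl⟩ := exists_term_of_coproduct w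
  obtain ⟨k, t, d, hk, ht⟩ := exists_termVal_eq (E := E) s
  rw [← ht, map_termVal] at hw
  have h₁ := congrArg (fstHom _ _) hw
  have h₂ := congrArg (sndHom _ _) hw
  rw [map_termVal] at h₁ h₂
  let e : Fin k → freeEmpty E := fun i => (d i).1
  let e' : Fin k → freeEmpty E := fun i => (d i).2
  -- The two identities hold at the free generators, so they transfer to any pair of elements of any
  -- algebra.
  have H : IsDiagonalising t e e' :=
    { one_le := hk
      fst := fun A x y => by
        have h₃ := congrArg (free.lift (fun i : X => ![x, y] i.down)) h₁
        rw [map_termVal] at h₃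
        refine Eq.trans ?_ h₃
        congr 1
        funext i
        exact (map_constVal _ (e i)).symm
      snd := fun A x y => by
        have h₃ := congrArg (free.lift (fun i : X => ![x, y] i.down)) h₂
        rw [map_termVal] at h₃
        refine Eq.trans ?_ h₃
        congr 1
        funext i
        exact (map_constVal _ (e' i)).symm }
  -- The diagonalising identities make δ a section of the canonical map for every X. Injectivity of
  -- that homomorphism then reduces both conditions to F(X)².
  have key : ∀ (X : Type u) (p), toSquare X (delta t e e' X p) = p := fun X p => by
    have h₁ := map_termVal (toSquare X ≫ fstHom _ _) t (inlHom _ D p.1) (inlHom _ D p.2)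
      (fun i => inrHom (free E X) D (e i, e' i))
    have h₂ := map_termVal (toSquare X ≫ sndHom _ _) t (inlHom _ D p.1) (inlHom _ D p.2)
      (fun i => inrHom (free E X) D (e i, e' i))
    exact Prod.ext (h₁.trans (H.fst _ _ _)) (h₂.trans (H.snd _ _ _))
  refine ⟨k, t, e, e', H, fun X x => ?_, fun X n s x => ?_⟩
  · apply (toSquare_bijective h X).1
    exact key X _
  · apply (toSquare_bijective h X).1
    rw [key, map_funMap]
    simp only [key]

end Coextensive

end VAlg

theorem proposition2p5 {L : FirstOrder.Language.{u, v}} [L.IsAlgebraic] (E : Set (L.Term ℕ × L.Term ℕ)) :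
    IsCoextensive (VAlg E) ↔
      ∃ (k : ℕ) (t : L.Term (Fin (k + 2))) (e e' : Fin k → VAlg.freeEmpty E),
        VAlg.IsDiagonalising t e e' ∧
        ∀ X : Type u,
          (∀ x : X, VAlg.delta t e e' X (VAlg.free.of E x, VAlg.free.of E x) =
            VAlg.coproduct.inl (VAlg.free E X)
              (VAlg.prod (VAlg.freeEmpty E) (VAlg.freeEmpty E)) (VAlg.free.of E x)) ∧
          VAlg.IsHomomorphism (VAlg.delta t e e' X) := by
  constructor
  · rintro ⟨_, h⟩
    obtain ⟨k, t, e, e', H⟩ := VAlg.exists_isDecomposing (h _ _)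
    exact ⟨k, t, e, e', H.isDiagonalising, fun X => ⟨H.delta_of X, H.delta_hom X⟩⟩
  · rintro ⟨k, t, e, e', H, hX⟩
    exact VAlg.IsDecomposing.isCoextensive ⟨H, fun X => (hX X).1, fun X => (hX X).2⟩
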